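/- Let $k\ge 1$ and $n>k$ be integers. An exact-repair regenerating code over a finite field $\mathbb F_q$ for an $(n,k,k)$ distributed storage system, with parameters $(\alpha,\beta,F)$, $F\ge1$, encodes every file of $F$ symbols of $\mathbb F_q$ into the contents $W_1,\dots,W_n$ of $n$ nodes, each consisting of $\alpha$ symbols of $\mathbb F_q$ (the encoding need not be linear), such that * (data recovery) the file is determined by the contents of the nodes in $\mathcal A$, for every $\mathcal A\subseteq\{1,\dots,n\}$ with $|\mathcal A|\ge k$; * (exact repair) for every node $x$ and every $\mathcal A\subseteq\{1,\dots,n\}\setminus\{x\}$ with $|\mathcal A|\ge k$, each helper $j\in\mathcal A$ can compute from $W_j$ a message of $\beta$ symbols (which may depend on $x$ and $\mathcal A$) such that $W_x$ is determined by the messages of all helpers in $\mathcal A$. Such a code operates at the normalized point $(\bar\alpha,\bar\beta)=(\alpha/F,\beta/F)$. A pair of real numbers is called achievable if it is a limit of points at which such codes operate, where $q$ and $(\alpha,\beta,F)$ may vary, while $n$ and $k$ are fixed. Then in the range $$\bar\alpha>0,\qquad \frac{k-1}{k}\le\frac{\bar\beta}{\bar\alpha}\le 1,$$ the optimum tradeoff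 between per-node capacity and repair bandwidth is given by $\bar\beta+(k-1)\bar\alpha\ge1$; that is, a real pair $(\bar\alpha,\bar\beta)$ in this range is achievable if and only if $$\bar\beta+(k-1)\bar\alpha\ge 1 .$$ Moreover, a rational pair $(\bar\alpha,\bar\beta)$ in this range satisfies this inequality if and only if some such code operates exactly at $(\bar\alpha,\bar\beta)$. -/

import Mathlib

/-- `W i m` is the content of node `i` when the file is `m`. The file consists of `F` symbols of the
alphabet `K`, there are `n` nodes, and each node has storage capacity `α` symbols. `W` is an
exact-repair regenerating code with parameters `(n, k, d)` and `(α, β)` if the file can be recovered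
from any at least `k` nodes, and the content of any node can be reproduced exactly from `β` symbols
sent by each member of any set of at least `d` other nodes. What a helper sends is a function of its
own content, and may depend on the failed node and on the set of helpers. Nothing is assumed to be
linear. -/
structure IsExactRepairCode {K : Type} {n F α : ℕ} (k d β : ℕ)
    (W : Fin n → (Fin F → K) → (Fin α → K)) : Prop where
  data_recovery : ∀ A : Finset (Fin n), k ≤ A.card →
    ∃ dec : (A → Fin α → K) → (Fin F → K),
      ∀ m : Fin F → K, dec (fun j => W j m) = m
  node_repair : ∀ (x : Fin n) (A : Finset (Fin n)), x ∉ A → d ≤ A.card →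
    ∃ (send : A → (Fin α → K) → (Fin β → K)) (rep : (A → Fin β → K) → (Fin α → K)),
      ∀ m : Fin F → K, rep (fun j => send j (W j m)) = W x m

/-- The pairs `(α / F, β / F)` (normalized per-node capacity and repair bandwidth) at which some
exact-repair regenerating code over some finite field operates. -/
def operatingPoints (n k d : ℕ) : Set (ℝ × ℝ) :=
  {p | ∃ (K : Type) (_ : Field K) (_ : Finite K) (F α β : ℕ)
      (W : Fin n → (Fin F → K) → (Fin α → K)),
      0 < F ∧ IsExactRepairCode k d β W ∧ p = ((α : ℝ) / F, (β : ℝ) / F)}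

/-- The achievable region: the pairs of reals that are limits of operating points. Its lower
boundary is the optimum tradeoff. -/
def achievableRegion (n k d : ℕ) : Set (ℝ × ℝ) :=
  closure (operatingPoints n k d)

/-! Write `k = r + 1`. The lower bound is a cut-set count (`IsExactRepairCode.file_size_le`): `r`
nodes and one helper message repair a further node, hence give the file, so `F ≤ β + r * α`; this
closed condition passes to limits. Conversely, two linear codes meet the bound at the ends of the
range. A Vandermonde code has `(α, β, F) = (1, 1, r + 1)`. A code whose file is a trace-zero square
matrix `M`, with node `t` storing `(1, t, ..., t ^ r) M`, has `(r + 1, r, r * r + 2 * r)`; the trace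
condition saves one symbol of repair per helper. Juxtaposing `p` matrix codes and `q` Vandermonde
codes (`exists_isExactRepairCode`) fills the range: exactly at rational pairs, and by rounding up at
real ones. -/

/-- Decoders need not be explicit: it suffices to choose any file consistent with the data received.
For the linear codes below, this leaves only kernels to compute. -/
theorem IsExactRepairCode.of_determined {K : Type} {n F α k d β : ℕ}
    {W : Fin n → (Fin F → K) → (Fin α → K)}
    (hdata : ∀ A : Finset (Fin n), k ≤ A.card →
      ∀ m m', (∀ j ∈ A, W j m = W j m') → m = m')
    (send : Fin n → (Fin α → K) → (Fin β → K))
    (hrep : ∀ (x : Fin n) (A : Finset (Fin n)), x ∉ A → d ≤ A.card →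
      ∀ m m', (∀ j ∈ A, send x (W j m) = send x (W j m')) → W x m = W x m')
    [Nonempty K] : IsExactRepairCode k d β W := by
  constructor
  · intro A hA
    have hinj : Function.Injective (fun (m : Fin F → K) (j : A) => W j m) := fun m m' h =>
      hdata A hA m m' fun j hj => congrFun h ⟨j, hj⟩
    exact ⟨Function.invFun _, Function.leftInverse_invFun hinj⟩
  · intro x A hx hA
    refine ⟨fun _ => send x,
      fun s => W x (Function.invFun (fun (m : Fin F → K) (j : A) => send x (W j m)) s), fun m => ?_⟩
    refine hrep x A hx hA _ _ fun j hj => ?_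
    exact congrFun (Function.invFun_eq
      (f := fun (m : Fin F → K) (j : A) => send x (W j m)) ⟨m, rfl⟩) ⟨j, hj⟩

/-- The cut-set bound: `k - 1` nodes together with one helper message determine the file. -/
theorem IsExactRepairCode.file_size_le {K : Type} [Finite K] [Nontrivial K] {n F α β r : ℕ}
    (hn : r + 1 < n) {W : Fin n → (Fin F → K) → (Fin α → K)}
    (hW : IsExactRepairCode (r + 1) (r + 1) β W) : F ≤ β + r * α := by
  classical
  let e : Fin r → Fin n := fun i => ⟨i, by omega⟩
  let x : Fin n := ⟨r, by omega⟩
  let y : Fin n := ⟨r + 1, hn⟩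
  have he : Function.Injective e := fun i j h => Fin.ext (by simpa [e] using h)
  let S : Finset (Fin n) := Finset.univ.image e
  have hS : S.card = r := by simp [S, Finset.card_image_of_injective _ he]
  have hxS : x ∉ S := by
    simp only [S, Finset.mem_image, not_exists, x, e, Fin.mk.injEq]
    rintro i ⟨-, h⟩
    omega
  have hyS : y ∉ S := by
    simp only [S, Finset.mem_image, not_exists, y, e, Fin.mk.injEq]
    rintro i ⟨-, h⟩
    omega
  have hxy : x ≠ y := by simp [x, y]
  obtain ⟨dec, hdec⟩ := hW.data_recovery (insert x S) (by
    rw [Finset.card_insert_of_notMem hxS, hS])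
  obtain ⟨send, rep, hrep⟩ := hW.node_repair x (insert y S)
    (by simp [hxy, hxS]) (by rw [Finset.card_insert_of_notMem hyS, hS])
  let g : (Fin F → K) → (Fin β → K) × (Fin r → Fin α → K) := fun m =>
    (send ⟨y, Finset.mem_insert_self _ _⟩ (W y m), fun i => W (e i) m)
  have hg : Function.Injective g := by
    intro m m' h
    have h1 := congrArg Prod.fst h
    have h2 : ∀ j ∈ S, W j m = W j m' := by
      intro j hj
      obtain ⟨i, -, rfl⟩ := Finset.mem_image.1 hj
      exact congrFun (congrArg Prod.snd h) i
    have hx : W x m = W x m' := by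
      rw [← hrep m, ← hrep m']
      congr 1
      funext j
      obtain ⟨j, hj⟩ := j
      rcases Finset.mem_insert.1 hj with rfl | hj'
      · exact h1
      · simp only [h2 j hj']
    rw [← hdec m, ← hdec m']
    congr 1
    funext j
    obtain ⟨j, hj⟩ := j
    rcases Finset.mem_insert.1 hj with rfl | hj'
    · exact hx
    · exact h2 j hj'
  have hcard := Nat.card_le_card_of_injective g hg
  simp only [Nat.card_prod, Nat.card_fun, Nat.card_eq_fintype_card, Fintype.card_fin,
    ← pow_mul, ← pow_add] at hcard
  rw [mul_comm α r] at hcard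
  exact (Nat.pow_le_pow_iff_right Finite.one_lt_card).1 hcard

theorem one_le_of_mem_operatingPoints {n r : ℕ} (hn : r + 1 < n) {p : ℝ × ℝ}
    (hp : p ∈ operatingPoints n (r + 1) (r + 1)) : 1 ≤ p.2 + r * p.1 := by
  obtain ⟨K, _, _, F, α, β, W, hF, hW, rfl⟩ := hp
  have h : (F : ℝ) ≤ β + r * α := by exact_mod_cast hW.file_size_le hn
  have hF' : (0 : ℝ) < F := by exact_mod_cast hF
  rw [mul_div_assoc', ← add_div, le_div_iff₀ hF', one_mul]
  exact h

/-! ### The trace-zero matrix code -/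

/-- A vector is determined by its products with the Vandermonde vectors of `k` distinct points. -/
theorem eq_zero_of_forall_mem_sum_pow_mul_eq_zero {K ι : Type*} [Field K] {k : ℕ} {v : ι → K}
    (hv : Function.Injective v) {A : Finset ι} (hA : k ≤ A.card) {w : Fin k → K}
    (h : ∀ j ∈ A, ∑ i : Fin k, v j ^ (i : ℕ) * w i = 0) : w = 0 := by
  obtain ⟨B, hBA, hB⟩ := Finset.exists_subset_card_eq hA
  let f : Fin k → ι := fun i => (B.equivFinOfCardEq hB).symm i
  have hf : Function.Injective f :=
    Subtype.val_injective.comp (B.equivFinOfCardEq hB).symm.injective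
  exact Matrix.eq_zero_of_forall_index_sum_pow_mul_eq_zero (hv.comp hf) fun j =>
    h _ (hBA ((B.equivFinOfCardEq hB).symm j).2)

/-- The content of a node with evaluation point `t`, for a file that consists of `p` square
matrices and `q` vectors. -/
def nodeContent {K : Type} [Field K] (p q r : ℕ) (t : K) :
    ((Fin p → Matrix (Fin (r + 1)) (Fin (r + 1)) K) × (Fin q → Fin (r + 1) → K)) →ₗ[K]
      (Fin p → Fin (r + 1) → K) × (Fin q → K) where
  toFun m := (fun s i => ∑ l : Fin (r + 1), t ^ (l : ℕ) * m.1 s l i,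
    fun s => ∑ l : Fin (r + 1), t ^ (l : ℕ) * m.2 s l)
  map_add' m m' := by
    ext <;> simp [mul_add, Finset.sum_add_distrib]
  map_smul' c m := by
    ext <;> simp [Finset.mul_sum, mul_left_comm]

/-- The message sent towards the repair of the node with evaluation point `t`. -/
def helperMessage {K : Type} [Field K] (p q r : ℕ) (t : K) :
    ((Fin p → Fin (r + 1) → K) × (Fin q → K)) →ₗ[K] (Fin p → Fin r → K) × (Fin q → K) where
  toFun c := (fun s i => c.1 s i.succ - t ^ (i.succ : ℕ) * c.1 s 0, c.2)
  map_add' c c' := by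
    ext
    · simp; ring
    · simp
  map_smul' a c := by
    ext
    · simp; ring
    · simp

theorem eq_zero_of_nodeContent_eq_zero {K ι : Type} [Field K] {p q r : ℕ} {v : ι → K}
    (hv : Function.Injective v) {A : Finset ι} (hA : r + 1 ≤ A.card)
    {m : (Fin p → Matrix (Fin (r + 1)) (Fin (r + 1)) K) × (Fin q → Fin (r + 1) → K)}
    (h : ∀ j ∈ A, nodeContent p q r (v j) m = 0) : m = 0 := by
  refine Prod.ext (funext fun s => ?_) (funext fun s => ?_)
  · ext l i
    exact congrFun (eq_zero_of_forall_mem_sum_pow_mul_eq_zero hv hA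
      (w := fun l => m.1 s l i) fun j hj => congrFun (congrFun (congrArg Prod.fst (h j hj)) s) i) l
  · exact eq_zero_of_forall_mem_sum_pow_mul_eq_zero hv hA
      (w := m.2 s) fun j hj => congrFun (congrArg Prod.snd (h j hj)) s

/-- Zero messages force column `i` of each matrix to be `t ^ i` times column `0`, so `M = u vᵀ` with
`v = (1, t, ..., t ^ r)`. Then `vᵀ u = trace M = 0`, and the content `vᵀ M = (vᵀ u) vᵀ` vanishes. -/
theorem nodeContent_eq_zero_of_helperMessage_eq_zero {K ι : Type} [Field K] {p q r : ℕ}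
    {v : ι → K} (hv : Function.Injective v) {A : Finset ι} (hA : r + 1 ≤ A.card) (t : K)
    {m : (Fin p → Matrix (Fin (r + 1)) (Fin (r + 1)) K) × (Fin q → Fin (r + 1) → K)}
    (hm : ∀ s, (m.1 s).trace = 0)
    (h : ∀ j ∈ A, helperMessage p q r t (nodeContent p q r (v j) m) = 0) :
    nodeContent p q r t m = 0 := by
  refine Prod.ext (funext fun s => ?_) (funext fun s => ?_)
  · have hcol : ∀ (i l : Fin (r + 1)), m.1 s l i = t ^ (i : ℕ) * m.1 s l 0 := by
      intro i l
      induction i using Fin.cases with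
      | zero => simp
      | succ i =>
        have := congrFun (eq_zero_of_forall_mem_sum_pow_mul_eq_zero hv hA
          (w := fun l => m.1 s l i.succ - t ^ (i.succ : ℕ) * m.1 s l 0) fun j hj => by
            have := congrFun (congrFun (congrArg Prod.fst (h j hj)) s) i
            simp only [helperMessage, nodeContent, LinearMap.coe_mk, AddHom.coe_mk] at this
            rw [← show _ = (0 : K) from this, Finset.mul_sum, ← Finset.sum_sub_distrib]
            exact Finset.sum_congr rfl fun l _ => by ring) l
        exact sub_eq_zero.1 this
    have htr : ∑ l : Fin (r + 1), t ^ (l : ℕ) * m.1 s l 0 = 0 := by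
      rw [← hm s]
      exact Finset.sum_congr rfl fun l _ => (hcol l l).symm
    funext i
    change ∑ l : Fin (r + 1), t ^ (l : ℕ) * m.1 s l i = 0
    rw [← mul_zero (t ^ (i : ℕ)), ← htr, Finset.mul_sum]
    exact Finset.sum_congr rfl fun l _ => by rw [hcol i l]; ring
  · have : m.2 s = 0 := eq_zero_of_forall_mem_sum_pow_mul_eq_zero hv hA
      (w := m.2 s) fun j hj => congrFun (congrArg Prod.snd (h j hj)) s
    change ∑ l : Fin (r + 1), t ^ (l : ℕ) * m.2 s l = 0
    simp [this]

theorem le_finrank_ker_trace (K : Type*) [Field K] (r : ℕ) :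
    r * r + 2 * r ≤ Module.finrank K
      (LinearMap.ker (Matrix.traceLinearMap (Fin (r + 1)) K K)) := by
  have h := LinearMap.finrank_range_add_finrank_ker (Matrix.traceLinearMap (Fin (r + 1)) K K)
  have h1 := Submodule.finrank_le (LinearMap.range (Matrix.traceLinearMap (Fin (r + 1)) K K))
  simp only [Module.finrank_matrix, Fintype.card_fin, Module.finrank_self] at h h1
  nlinarith

theorem exists_isExactRepairCode (n p q r F : ℕ)
    (hF : F ≤ p * (r * r + 2 * r) + q * (r + 1)) :
    ∃ (K : Type) (_ : Field K) (_ : Finite K)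
      (W : Fin n → (Fin F → K) → (Fin (p * (r + 1) + q) → K)),
      IsExactRepairCode (r + 1) (r + 1) (p * r + q) W := by
  -- A prime `P ≥ n` gives the `n` nodes distinct evaluation points.
  obtain ⟨P, hnP, hP⟩ := Nat.exists_infinite_primes n
  have : Fact P.Prime := ⟨hP⟩
  let K := ZMod P
  let v : Fin n → K := fun i => ((i : ℕ) : ZMod P)
  have hv : Function.Injective v := by
    intro i j hij
    have := (ZMod.natCast_eq_natCast_iff' _ _ _).1 hij
    rw [Nat.mod_eq_of_lt (by omega), Nat.mod_eq_of_lt (by omega)] at this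
    exact Fin.ext this
  let T := LinearMap.ker (Matrix.traceLinearMap (Fin (r + 1)) K K)
  obtain ⟨φ, hφ⟩ : ∃ φ : (Fin F → K) →ₗ[K] (Fin p → T) × (Fin q → Fin (r + 1) → K),
      Function.Injective φ := by
    have hT : r * r + 2 * r ≤ Module.finrank K T := le_finrank_ker_trace K r
    refine rank_le_iff_exists_linearMap.1 ?_
    rw [← Module.finrank_eq_rank, ← Module.finrank_eq_rank, Nat.cast_le]
    simp only [Module.finrank_prod, Module.finrank_pi_fintype, Module.finrank_self,
      Finset.sum_const, Finset.card_univ, Fintype.card_fin, smul_eq_mul, mul_one]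
    exact hF.trans (Nat.add_le_add_right (Nat.mul_le_mul_left p hT) _)
  let ψ : ((Fin p → T) × (Fin q → Fin (r + 1) → K)) →ₗ[K]
      (Fin p → Matrix (Fin (r + 1)) (Fin (r + 1)) K) × (Fin q → Fin (r + 1) → K) :=
    (LinearMap.compLeft T.subtype (Fin p)).prodMap LinearMap.id
  let file := ψ ∘ₗ φ
  have hψ : Function.Injective ψ := fun x y h =>
    Prod.ext (funext fun s => Subtype.ext (congrFun (congrArg Prod.fst h) s))
      (show (ψ x).2 = (ψ y).2 from congrArg Prod.snd h)
  have hfile : Function.Injective file := hψ.comp hφ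
  have htrace : ∀ m s, ((file m).1 s).trace = 0 := fun m s => ((φ m).1 s).2
  let c : ((Fin p → Fin (r + 1) → K) × (Fin q → K)) ≃ₗ[K] (Fin (p * (r + 1) + q) → K) :=
    LinearEquiv.ofFinrankEq _ _ (by simp [Module.finrank_pi_fintype])
  let b : ((Fin p → Fin r → K) × (Fin q → K)) ≃ₗ[K] (Fin (p * r + q) → K) :=
    LinearEquiv.ofFinrankEq _ _ (by simp [Module.finrank_pi_fintype])
  refine ⟨K, inferInstance, inferInstance, fun j m => c (nodeContent p q r (v j) (file m)), ?_⟩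
  refine IsExactRepairCode.of_determined ?_
    (fun x w => b (helperMessage p q r (v x) (c.symm w))) ?_
  · intro A hA m m' h
    refine sub_eq_zero.1 (hfile ?_)
    rw [map_zero]
    refine eq_zero_of_nodeContent_eq_zero hv hA fun j hj => ?_
    rw [map_sub, map_sub, sub_eq_zero]
    exact c.injective (h j hj)
  · intro x A _ hA m m' h
    refine congrArg c (sub_eq_zero.1 ?_)
    rw [← map_sub, ← map_sub]
    refine nodeContent_eq_zero_of_helperMessage_eq_zero hv hA _ (htrace _) fun j hj => ?_
    have := b.injective (h j hj)
    simp only [LinearEquiv.symm_apply_apply] at this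
    rw [map_sub, map_sub, map_sub, this, sub_self]

/-! ### Filling the range -/

theorem mem_operatingPoints_of_le (n : ℕ) {p q r F : ℕ} (hF0 : 0 < F)
    (hF : (F : ℝ) ≤ (p * r + q) + r * (p * (r + 1) + q)) :
    (((p * (r + 1) + q : ℝ)) / F, ((p * r + q : ℝ)) / F) ∈
      operatingPoints n (r + 1) (r + 1) := by
  have hF' : F ≤ p * (r * r + 2 * r) + q * (r + 1) := by
    have : (F : ℝ) ≤ p * (r * r + 2 * r) + q * (r + 1) := hF.trans_eq (by ring)
    exact_mod_cast this
  obtain ⟨K, h1, h2, W, hW⟩ := exists_isExactRepairCode n p q r F hF'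
  exact ⟨K, h1, h2, F, _, _, W, hF0, hW, by push_cast; rfl⟩

theorem mem_achievableRegion_of_one_le (n : ℕ) {r : ℕ} {a b : ℝ} (hba : b ≤ a)
    (hab : r * a ≤ (r + 1) * b) (h : 1 ≤ b + r * a) :
    (a, b) ∈ achievableRegion n (r + 1) (r + 1) := by
  -- The weights `a - b` and `(r + 1) * b - r * a` solve `p * (r + 1) + q = a`, `p * r + q = b`; the
  -- range is exactly where both are nonnegative.
  have hp : 0 ≤ a - b := by linarith
  have hq : 0 ≤ (r + 1) * b - r * a := by linarith
  have tp := (tendsto_nat_ceil_mul_div_atTop hp).comp (tendsto_natCast_atTop_atTop (R := ℝ))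
  have tq := (tendsto_nat_ceil_mul_div_atTop hq).comp (tendsto_natCast_atTop_atTop (R := ℝ))
  have t1 := ((tp.mul_const ((r : ℝ) + 1)).add tq)
  have t2 := ((tp.mul_const (r : ℝ)).add tq)
  rw [show (a - b) * ((r : ℝ) + 1) + ((r + 1) * b - r * a) = a by ring] at t1
  rw [show (a - b) * (r : ℝ) + ((r + 1) * b - r * a) = b by ring] at t2
  refine mem_closure_of_tendsto (t1.prodMk_nhds t2) ?_
  filter_upwards [Filter.eventually_gt_atTop 0] with N hN
  -- Rounding up only enlarges the capacity, so a file of `N` symbols still fits.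
  have hcp := Nat.le_ceil ((a - b) * (N : ℝ))
  have hcq := Nat.le_ceil (((r + 1) * b - r * a) * (N : ℝ))
  have hr : (0 : ℝ) ≤ r := Nat.cast_nonneg r
  have hN' : (0 : ℝ) ≤ N := Nat.cast_nonneg N
  convert mem_operatingPoints_of_le n (p := ⌈(a - b) * (N : ℝ)⌉₊)
    (q := ⌈((r + 1) * b - r * a) * (N : ℝ)⌉₊) hN ?_ using 2
  · simp only [Function.comp_apply]; ring
  · simp only [Function.comp_apply]; ring
  · have e1 := mul_le_mul_of_nonneg_right hcp (show (0 : ℝ) ≤ r * r + 2 * r by positivity)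
    have e2 := mul_le_mul_of_nonneg_right hcq (show (0 : ℝ) ≤ r + 1 by positivity)
    have e3 := mul_le_mul_of_nonneg_right h hN'
    linarith

theorem mem_operatingPoints_of_one_le_rat (n : ℕ) {r : ℕ} {a b : ℚ} (hba : b ≤ a)
    (hab : r * a ≤ (r + 1) * b) (h : 1 ≤ b + r * a) :
    ((a : ℝ), (b : ℝ)) ∈ operatingPoints n (r + 1) (r + 1) := by
  -- With a common denominator as file size, both weights scale to integers and no rounding is
  -- needed.
  let N := a.den * b.den
  have hN : 0 < N := Nat.mul_pos a.pos b.pos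
  have hNq : (0 : ℚ) < N := by exact_mod_cast hN
  have ha : a * N = ((a.num * b.den : ℤ) : ℚ) := by
    simp only [N]; push_cast; rw [← mul_assoc, Rat.mul_den_eq_num]
  have hb : b * N = ((b.num * a.den : ℤ) : ℚ) := by
    simp only [N]; push_cast; rw [mul_left_comm, Rat.mul_den_eq_num, mul_comm]
  have lift_nat : ∀ (z : ℤ) (x : ℚ), 0 ≤ x → x = z → ∃ p : ℕ, (p : ℚ) = x := by
    rintro z x hx rfl
    exact ⟨z.toNat, by exact_mod_cast Int.toNat_of_nonneg (by exact_mod_cast hx)⟩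
  obtain ⟨p, hp⟩ := lift_nat (a.num * b.den - b.num * a.den) ((a - b) * N)
    (mul_nonneg (by linarith) hNq.le) (by rw [Int.cast_sub, ← ha, ← hb]; ring)
  obtain ⟨q, hq⟩ := lift_nat ((r + 1) * (b.num * a.den) - r * (a.num * b.den))
    (((r + 1) * b - r * a) * N) (mul_nonneg (by linarith) hNq.le)
    (by rw [Int.cast_sub, Int.cast_mul, Int.cast_mul _ (a.num * _), ← ha, ← hb]; push_cast; ring)
  have e1 : (p * (r + 1) + q : ℚ) = a * N := by rw [hp, hq]; ring
  have e2 : (p * r + q : ℚ) = b * N := by rw [hp, hq]; ring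
  have hF : (N : ℚ) ≤ (p * r + q) + r * (p * (r + 1) + q) := by
    rw [e1, e2]
    linarith [mul_le_mul_of_nonneg_right h hNq.le]
  have e1' : (p * (r + 1) + q : ℝ) = a * N := by exact_mod_cast e1
  have e2' : (p * r + q : ℝ) = b * N := by exact_mod_cast e2
  have hNr : (N : ℝ) ≠ 0 := by exact_mod_cast hN.ne'
  have := mem_operatingPoints_of_le n (p := p) (q := q) (r := r) hN (by exact_mod_cast hF)
  rwa [e1', e2', mul_div_cancel_right₀ _ hNr, mul_div_cancel_right₀ _ hNr] at this

theorem mainTheorem5 (n k : ℕ) (hk : 1 ≤ k) (hn : k < n) :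
    (∀ a b : ℝ, 0 < a → ((k : ℝ) - 1) / k ≤ b / a → b / a ≤ 1 →
      ((a, b) ∈ achievableRegion n k k ↔ 1 ≤ b + ((k : ℝ) - 1) * a)) ∧
    (∀ a b : ℚ, 0 < a → ((k : ℚ) - 1) / k ≤ b / a → b / a ≤ 1 →
      (((a : ℝ), (b : ℝ)) ∈ operatingPoints n k k ↔ 1 ≤ b + ((k : ℚ) - 1) * a)) := by
  obtain ⟨r, rfl⟩ : ∃ r, k = r + 1 := ⟨k - 1, by omega⟩
  simp only [Nat.cast_add, Nat.cast_one, add_sub_cancel_right]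
  constructor
  · intro a b ha h1 h2
    rw [div_le_div_iff₀ (by positivity) ha] at h1
    rw [div_le_one ha] at h2
    refine ⟨fun h => ?_, mem_achievableRegion_of_one_le n h2 (by linarith)⟩
    have hclosed : IsClosed {p : ℝ × ℝ | 1 ≤ p.2 + r * p.1} :=
      isClosed_le continuous_const (by fun_prop)
    exact closure_minimal (fun p hp => one_le_of_mem_operatingPoints hn hp) hclosed h
  · intro a b ha h1 h2
    rw [div_le_div_iff₀ (by positivity) ha] at h1
    rw [div_le_one ha] at h2
    refine ⟨fun h => ?_, mem_operatingPoints_of_one_le_rat n h2 (by linarith)⟩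
    have := one_le_of_mem_operatingPoints hn h
    dsimp only at this
    exact_mod_cast this
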